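/- Let $G$ be a finitely generated torsion-free (Gromov) hyperbolic group. A coloring of $G$ by a set $F$ of colors is a map $\phi\colon G\to F$; $G$ acts on colorings by $(g\phi)(x)=\phi(g^{-1}x)$, and $F^G$ carries the product topology, with $F$ discrete. A coloring $\phi$ is called limit aperiodic if every coloring $\psi$ in the closure $\overline{G\phi}$ of its orbit has trivial stabilizer, that is, $g\psi\neq\psi$ for all $g\in G\setminus\{e\}$. Then $G$ admits a limit aperiodic coloring by $9$ colors. More precisely, there exist square-free sequences $\nu\colon\mathbb N\to\{0,1,2\}$ (sequences that contain no block of consecutive terms of the form $WW$ with $W$ a nonempty word), and for every such $\nu$ and every finite generating set $S$ of $G$, with $\|g\|$ denoting the word norm of $g$ with respect to $S$, the coloring $$\phi\colon G\to\{0,1,2\}\times\{0,1,2\},\qquad \phi(g)=(\nu(\|g\|),\ \|g\| \bmod 3),$$ is limit aperiodic. -/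

import Mathlib

namespace AperiodicColoring

section Words

variable {G : Type*} [Group G]

/-- The word norm `‖g‖` with respect to `S`: the least length of a word in the letters
`S ∪ S⁻¹` that represents `g`. (It is used only when `S` generates `G`.) -/
noncomputable def wordNorm (S : Finset G) (g : G) : ℕ :=
  sInf {n : ℕ | ∃ l : List G, (∀ x ∈ l, x ∈ S ∨ x⁻¹ ∈ S) ∧ l.prod = g ∧ l.length = n}

/-- The (left invariant) word metric `d(x, y) = ‖x⁻¹ y‖`. -/
noncomputable def wordDist (S : Finset G) (x y : G) : ℕ :=
  wordNorm S (x⁻¹ * y)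

/-- The Gromov product `(x | y)_w` for the word metric. -/
noncomputable def gromovProduct (S : Finset G) (w x y : G) : ℝ :=
  ((wordDist S w x : ℝ) + (wordDist S w y : ℝ) - (wordDist S x y : ℝ)) / 2

end Words

/-- Gromov hyperbolic groups: for some finite generating set, the word metric is
`δ`-hyperbolic for some `δ`. In particular such a group is finitely generated. -/
def IsHyperbolicGroup (G : Type*) [Group G] : Prop :=
  ∃ S : Finset G, Subgroup.closure (S : Set G) = ⊤ ∧
    ∃ δ : ℝ, ∀ w x y z : G,
      min (gromovProduct S w x y) (gromovProduct S w y z) - δ ≤ gromovProduct S w x z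

/-- Torsion-free groups: no nontrivial element has finite order. -/
def IsTorsionFreeGroup (G : Type*) [Group G] : Prop :=
  ∀ g : G, g ≠ 1 → ¬ IsOfFinOrder g

section Colorings

variable {G : Type*} [Group G] {F : Type*}

/-- The left action of `G` on colorings, `(g φ)(x) = φ(g⁻¹ x)`. -/
def translate (g : G) (φ : G → F) : G → F :=
  fun x => φ (g⁻¹ * x)

/-- A coloring is aperiodic if its stabilizer is trivial. -/
def IsAperiodic (φ : G → F) : Prop :=
  ∀ g : G, g ≠ 1 → translate g φ ≠ φ

/-- A coloring is limit aperiodic if every coloring in the closure of its orbit, in the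
product topology on `G → F` with `F` discrete, is aperiodic. -/
def IsLimitAperiodic [TopologicalSpace F] [DiscreteTopology F] (φ : G → F) : Prop :=
  ∀ ψ ∈ closure (Set.range fun g : G => translate g φ), IsAperiodic ψ

end Colorings

/-- A sequence is square-free if it contains no block of consecutive terms of the form `WW`
with `W` a nonempty word. -/
def IsSquareFreeSeq {A : Type*} (ν : ℕ → A) : Prop :=
  ∀ i n : ℕ, 0 < n → ∃ j < n, ν (i + j) ≠ ν (i + n + j)

/-- The coloring `g ↦ (ν(‖g‖), ‖g‖ mod 3)`. -/
noncomputable def normColoring {G : Type*} [Group G] (S : Finset G) (ν : ℕ → Fin 3) (g : G) :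
    Fin 3 × Fin 3 :=
  (ν (wordNorm S g), ⟨wordNorm S g % 3, Nat.mod_lt _ (by norm_num)⟩)

end AperiodicColoring

/-! Suppose g ≠ 1 is a period of a limit coloring ψ. On any finite ball, ψ is y ↦ (ν(d(p, y)), d(p,
y) mod 3) for some centre p. Distances to p change by at most 1 along an edge, so their residues mod
3 determine the changes, and d(p, gy) − d(p, y) is a constant c depending only on ψ and g
(`exists_wordDist_shift`). If c > 0, reading ν along a geodesic to p exhibits a square
(`shift_nonpos`); the same for g⁻¹ leaves c = 0. Thus any finite set of powers of g preserves the
distance to p on a large ball, and p lies outside that ball, since otherwise gp = p.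

Hyperbolicity now enters (`exists_conj_wordNorm_le`): geodesics to p from 1 and from a power a of g
come close, at nearly equal times because a preserves distances to p. So all these powers move one
common point s by at most C, where C does not depend on how many powers are used. With more powers
than elements in the ball of radius C, two of the s⁻¹gⁱs coincide, against torsion-freeness.
Hyperbolicity is given for one generating set and the coloring may use another; the Morse-type
`exists_geodesic_near_quasigeodesic` bridges the two metrics. -/

namespace AperiodicColoring

/-! ### Word metrics and their geodesics -/

section WordMetric

variable {G : Type*} [Group G] {S : Finset G}

theorem wordNorm_prod_le {l : List G} (hl : ∀ x ∈ l, x ∈ S ∨ x⁻¹ ∈ S) :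
    wordNorm S l.prod ≤ l.length :=
  Nat.sInf_le ⟨l, hl, rfl, rfl⟩

theorem exists_word (hS : Subgroup.closure (S : Set G) = ⊤) (g : G) :
    ∃ l : List G, (∀ x ∈ l, x ∈ S ∨ x⁻¹ ∈ S) ∧ l.prod = g ∧ l.length = wordNorm S g := by
  have hg : g ∈ Subgroup.closure (S : Set G) := hS ▸ Subgroup.mem_top g
  rw [← Subgroup.mem_toSubmonoid, Subgroup.closure_toSubmonoid] at hg
  obtain ⟨l, hl, hp⟩ := Submonoid.exists_list_of_mem_closure hg
  replace hl : ∀ x ∈ l, x ∈ S ∨ x⁻¹ ∈ S := fun x hx => by simpa using hl x hx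
  exact Nat.sInf_mem (s := {n : ℕ | ∃ l : List G, (∀ x ∈ l, x ∈ S ∨ x⁻¹ ∈ S) ∧ l.prod = g ∧
    l.length = n}) ⟨l.length, l, hl, hp, rfl⟩

theorem wordNorm_one : wordNorm S (1 : G) = 0 :=
  Nat.le_zero.1 (wordNorm_prod_le (S := S) (l := []) (by simp))

theorem wordNorm_mul_le (hS : Subgroup.closure (S : Set G) = ⊤) (a b : G) :
    wordNorm S (a * b) ≤ wordNorm S a + wordNorm S b := by
  obtain ⟨l, hl, rfl, hln⟩ := exists_word hS a
  obtain ⟨m, hm, rfl, hmn⟩ := exists_word hS b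
  rw [← hln, ← hmn, ← List.prod_append, ← List.length_append]
  refine wordNorm_prod_le fun x hx => ?_
  rcases List.mem_append.1 hx with h | h
  exacts [hl x h, hm x h]

theorem wordNorm_inv_le (hS : Subgroup.closure (S : Set G) = ⊤) (a : G) :
    wordNorm S a⁻¹ ≤ wordNorm S a := by
  obtain ⟨l, hl, rfl, hln⟩ := exists_word hS a
  rw [← hln, List.prod_inv_reverse]
  refine (wordNorm_prod_le fun x hx => ?_).trans (by simp)
  obtain ⟨y, hy, rfl⟩ := List.mem_map.1 (List.mem_reverse.1 hx)
  rw [inv_inv]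
  exact (hl y hy).symm

theorem wordNorm_inv (hS : Subgroup.closure (S : Set G) = ⊤) (a : G) :
    wordNorm S a⁻¹ = wordNorm S a :=
  (wordNorm_inv_le hS a).antisymm (by simpa using wordNorm_inv_le hS a⁻¹)

theorem eq_one_of_wordNorm_eq_zero (hS : Subgroup.closure (S : Set G) = ⊤) {a : G}
    (h : wordNorm S a = 0) : a = 1 := by
  obtain ⟨l, -, rfl, hln⟩ := exists_word hS a
  rw [h, List.length_eq_zero_iff] at hln
  simp [hln]

theorem wordDist_self (x : G) : wordDist S x x = 0 := by
  simp [wordDist, wordNorm_one]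

theorem wordDist_one_left (x : G) : wordDist S 1 x = wordNorm S x := by
  simp [wordDist]

theorem wordDist_comm (hS : Subgroup.closure (S : Set G) = ⊤) (x y : G) :
    wordDist S x y = wordDist S y x := by
  rw [wordDist, ← wordNorm_inv hS]
  simp [wordDist]

theorem wordDist_triangle (hS : Subgroup.closure (S : Set G) = ⊤) (x y z : G) :
    wordDist S x z ≤ wordDist S x y + wordDist S y z := by
  have := wordNorm_mul_le hS (x⁻¹ * y) (y⁻¹ * z)
  simpa [wordDist, mul_assoc] using this

theorem eq_of_wordDist_eq_zero (hS : Subgroup.closure (S : Set G) = ⊤) {x y : G}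
    (h : wordDist S x y = 0) : x = y :=
  inv_mul_eq_one.1 (eq_one_of_wordNorm_eq_zero hS h)

theorem wordDist_mul_left (g x y : G) : wordDist S (g * x) (g * y) = wordDist S x y := by
  simp [wordDist, mul_assoc]

theorem finite_wordNorm_le (hS : Subgroup.closure (S : Set G) = ⊤) (n : ℕ) :
    {g : G | wordNorm S g ≤ n}.Finite := by
  induction n with
  | zero =>
    refine (Set.finite_singleton (1 : G)).subset fun g hg => ?_
    exact eq_one_of_wordNorm_eq_zero hS (Nat.le_zero.1 hg)
  | succ n ih =>
    open scoped Pointwise in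
    have hfin : (((S : Set G) ∪ (S : Set G)⁻¹) * {g : G | wordNorm S g ≤ n}).Finite :=
      ((S.finite_toSet).union (S.finite_toSet.inv)).mul ih
    refine (ih.union hfin).subset fun g hg => ?_
    obtain ⟨l, hl, rfl, hln⟩ := exists_word hS g
    rw [Set.mem_ofPred_eq, ← hln] at hg
    rcases l with _ | ⟨a, l⟩
    · left
      simp [wordNorm_one]
    · right
      rw [List.prod_cons]
      refine Set.mul_mem_mul ?_ ?_
      · simpa using hl a (by simp)
      · refine (wordNorm_prod_le fun x hx => hl x (by simp [hx])).trans ?_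
        simpa using hg

/-- Makes geodesics of one word metric quasi-geodesics of another. The constant is the largest
`S`-norm of a letter of `S'`. -/
theorem exists_wordNorm_le_mul {S' : Finset G} (hS : Subgroup.closure (S : Set G) = ⊤)
    (hS' : Subgroup.closure (S' : Set G) = ⊤) :
    ∃ L : ℕ, ∀ g : G, wordNorm S g ≤ L * wordNorm S' g := by
  refine ⟨S'.sup (wordNorm S), fun g => ?_⟩
  obtain ⟨l, hl, rfl, hln⟩ := exists_word hS' g
  rw [← hln]
  clear hln
  induction l with
  | nil => simp [wordNorm_one]
  | cons a l ih =>
    rw [List.prod_cons, List.length_cons, mul_add, mul_one, add_comm]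
    refine (wordNorm_mul_le hS _ _).trans (add_le_add ?_ (ih fun x hx => hl x (by simp [hx])))
    rcases hl a (by simp) with h | h
    · exact Finset.le_sup (f := wordNorm S) h
    · rw [← wordNorm_inv hS]
      exact Finset.le_sup (f := wordNorm S) h

theorem wordDist_le_of_steps (hS : Subgroup.closure (S : Set G) = ⊤) {f : ℕ → G}
    (hf : ∀ i, wordDist S (f i) (f (i + 1)) ≤ 1) (i k : ℕ) : wordDist S (f i) (f (i + k)) ≤ k := by
  induction k with
  | zero => simp [wordDist_self]
  | succ k ih =>
    have := wordDist_triangle hS (f i) (f (i + k)) (f (i + k + 1))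
    have := hf (i + k)
    rw [← add_assoc]
    omega

/-- A path with unit steps whose ends are as far apart as its length is geodesic. -/
theorem wordDist_eq_of_steps (hS : Subgroup.closure (S : Set G) = ⊤) {f : ℕ → G}
    (hf : ∀ i, wordDist S (f i) (f (i + 1)) ≤ 1) {n : ℕ} (hn : wordDist S (f 0) (f n) = n)
    {i j : ℕ} (hij : i ≤ j) (hj : j ≤ n) : wordDist S (f i) (f j) = j - i := by
  have h1 := wordDist_le_of_steps hS hf 0 i
  have h2 := wordDist_le_of_steps hS hf i (j - i)
  have h3 := wordDist_le_of_steps hS hf j (n - j)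
  rw [zero_add] at h1
  rw [Nat.add_sub_cancel' hij] at h2
  rw [Nat.add_sub_cancel' hj] at h3
  have h4 := wordDist_triangle hS (f 0) (f i) (f n)
  have h5 := wordDist_triangle hS (f i) (f j) (f n)
  omega

theorem exists_geodesic (hS : Subgroup.closure (S : Set G) = ⊤) (x y : G) :
    ∃ f : ℕ → G, f 0 = x ∧ f (wordDist S x y) = y ∧ ∀ i, wordDist S (f i) (f (i + 1)) ≤ 1 := by
  obtain ⟨l, hl, hp, hln⟩ := exists_word hS (x⁻¹ * y)
  refine ⟨fun n => x * (l.take n).prod, by simp, ?_, fun i => ?_⟩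
  · simp [wordDist, ← hln, hp]
  · rw [wordDist_mul_left]
    by_cases h : i < l.length
    · rw [List.prod_take_succ _ _ h, wordDist, inv_mul_cancel_left]
      simpa using wordNorm_prod_le (S := S) (l := [l[i]]) (by simpa using hl _ (l.getElem_mem h))
    · rw [List.take_of_length_le (by omega), List.take_of_length_le (by omega), wordDist_self]
      exact zero_le_one

theorem exists_between (hS : Subgroup.closure (S : Set G) = ⊤) (x y : G) {k : ℕ}
    (hk : k ≤ wordDist S x y) :
    ∃ q, wordDist S x q = k ∧ wordDist S q y = wordDist S x y - k := by
  obtain ⟨f, h0, h1, hf⟩ := exists_geodesic hS x y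
  have hn : wordDist S (f 0) (f (wordDist S x y)) = wordDist S x y := by rw [h0, h1]
  refine ⟨f k, ?_, ?_⟩
  · simpa [h0] using wordDist_eq_of_steps hS hf hn (Nat.zero_le k) hk
  · simpa [h1] using wordDist_eq_of_steps hS hf hn hk le_rfl

end WordMetric

/-! ### Hyperbolic geometry: stability of quasi-geodesics and fellow travelling -/

section Hyperbolic

variable {G : Type*} [Group G] {S : Finset G} {δ : ℝ}

theorem gromovProduct_comm (hS : Subgroup.closure (S : Set G) = ⊤) (w x y : G) :
    gromovProduct S w x y = gromovProduct S w y x := by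
  rw [gromovProduct, gromovProduct, wordDist_comm hS x y]
  ring

theorem gromovProduct_self (w x : G) : gromovProduct S w x x = wordDist S w x := by
  simp [gromovProduct, wordDist_self]

/-- Gromov products degrade only logarithmically along a path. -/
theorem exists_step_gromovProduct_le (hδ0 : 0 ≤ δ)
    (hδ : ∀ w x y z : G,
      min (gromovProduct S w x y) (gromovProduct S w y z) - δ ≤ gromovProduct S w x z)
    (f : ℕ → G) (w : G) (k : ℕ) : ∀ a b : ℕ, a < b → b ≤ a + 2 ^ k →
      ∃ i, a ≤ i ∧ i < b ∧
        gromovProduct S w (f i) (f (i + 1)) ≤ gromovProduct S w (f a) (f b) + k * δ := by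
  induction k with
  | zero =>
    intro a b hab hb
    obtain rfl : b = a + 1 := by simp at hb; omega
    exact ⟨a, le_rfl, hab, by simp⟩
  | succ k ih =>
    intro a b hab hb
    rw [pow_succ] at hb
    push_cast
    by_cases hb' : b ≤ a + 2 ^ k
    · obtain ⟨i, h1, h2, h3⟩ := ih a b hab hb'
      exact ⟨i, h1, h2, by linarith⟩
    · have hpos : 0 < 2 ^ k := by positivity
      have h := hδ w (f a) (f (a + 2 ^ k)) (f b)
      rcases min_choice (gromovProduct S w (f a) (f (a + 2 ^ k)))
        (gromovProduct S w (f (a + 2 ^ k)) (f b)) with hm | hm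
      · obtain ⟨i, h1, h2, h3⟩ := ih a (a + 2 ^ k) (by omega) le_rfl
        exact ⟨i, h1, by omega, by linarith⟩
      · obtain ⟨i, h1, h2, h3⟩ := ih (a + 2 ^ k) b (by omega) (by omega)
        exact ⟨i, by omega, h2, by linarith⟩

/-- Consecutive path points are at least M from w and at most L apart, so their Gromov product is at
least M − L; dyadic subdivision loses at most kδ. -/
theorem le_gromovProduct_of_path (hS : Subgroup.closure (S : Set G) = ⊤) (hδ0 : 0 ≤ δ)
    (hδ : ∀ w x y z : G,
      min (gromovProduct S w x y) (gromovProduct S w y z) - δ ≤ gromovProduct S w x z)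
    {f : ℕ → G} {w : G} {n L M k : ℕ} (hstep : ∀ i < n, wordDist S (f i) (f (i + 1)) ≤ L)
    (hfar : ∀ i ≤ n, M ≤ wordDist S w (f i)) {a b : ℕ} (ha : a ≤ n) (hb : b ≤ n)
    (hab : b ≤ a + 2 ^ k) (hba : a ≤ b + 2 ^ k) :
    (M : ℝ) - L - k * δ ≤ gromovProduct S w (f a) (f b) := by
  wlog hlt : a ≤ b generalizing a b
  · rw [gromovProduct_comm hS]
    exact this hb ha hba hab (by omega)
  have hk : 0 ≤ k * δ := by positivity
  have hL : (0 : ℝ) ≤ L := by positivity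
  rcases hlt.eq_or_lt with rfl | hlt
  · rw [gromovProduct_self]
    have : (M : ℝ) ≤ wordDist S w (f a) := by exact_mod_cast hfar a ha
    linarith
  · obtain ⟨i, h1, h2, h3⟩ := exists_step_gromovProduct_le hδ0 hδ f w k a b hlt hab
    have e1 : (M : ℝ) ≤ wordDist S w (f i) := by exact_mod_cast hfar i (by omega)
    have e2 : (M : ℝ) ≤ wordDist S w (f (i + 1)) := by exact_mod_cast hfar (i + 1) (by omega)
    have e3 : (wordDist S (f i) (f (i + 1)) : ℝ) ≤ L := by exact_mod_cast hstep i (by omega)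
    have : (M : ℝ) - L ≤ gromovProduct S w (f i) (f (i + 1)) := by
      rw [gromovProduct]
      linarith
    linarith

/-- The hypothesis bounds M by a constant plus a multiple of log M. -/
theorem exists_bound_of_le_log (δ : ℝ) (L : ℕ) :
    ∃ C : ℕ, ∀ M : ℕ, (∀ k : ℕ, 6 * L * M ≤ 2 ^ k → (M : ℝ) ≤ L + (k + 2) * δ) → M ≤ C := by
  obtain ⟨A, hA⟩ := exists_nat_ge δ
  have hlog : ∀ B : ℕ, ∃ k₀ : ℕ, ∀ k ≥ k₀, B * k < 2 ^ k := by
    intro B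
    have h := (isLittleO_pow_const_const_pow_of_one_lt (R := ℝ) 1 one_lt_two).bound
      (show (0 : ℝ) < 1 / (B + 1) by positivity)
    obtain ⟨k₀, hk₀⟩ := Filter.eventually_atTop.1 h
    refine ⟨k₀, fun k hk => ?_⟩
    have h1 := hk₀ k hk
    simp only [pow_one, Real.norm_natCast, norm_pow, Real.norm_ofNat] at h1
    rw [one_div, inv_mul_eq_div, le_div_iff₀ (by positivity)] at h1
    have h2 : k * (B + 1) ≤ 2 ^ k := by exact_mod_cast h1
    rcases Nat.eq_zero_or_pos k with rfl | hpos
    · simp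
    · nlinarith
  -- For 2 ^ k < 6LM ≤ 2 ^ (k + 1) with k ≥ 1, the hypothesis gives M ≤ L + (k + 3)A ≤ (L + 4A)k,
  -- whence 2 ^ k < 6L(L + 4A)k.
  obtain ⟨k₀, hk₀⟩ := hlog (6 * L * (L + 4 * A))
  refine ⟨L + (k₀ + 3) * A, fun M hM => ?_⟩
  replace hM : ∀ k : ℕ, 6 * L * M ≤ 2 ^ k → M ≤ L + (k + 2) * A := by
    intro k hk
    have h1 := hM k hk
    have h2 : ((k : ℝ) + 2) * δ ≤ (k + 2) * A := by gcongr
    exact_mod_cast h1.trans (add_le_add_right h2 _)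
  have hk := hM _ (Nat.le_pow_clog one_lt_two (6 * L * M))
  by_cases hle : Nat.clog 2 (6 * L * M) ≤ k₀ + 1
  · exact hk.trans (by gcongr L + ?_ * A; omega)
  · obtain ⟨k, hkk⟩ : ∃ k, Nat.clog 2 (6 * L * M) = k + 1 := ⟨_, (Nat.sub_add_cancel (by omega)).symm⟩
    rw [hkk] at hk
    have h1 : 2 ^ k < 6 * L * M := (Nat.lt_clog_iff_pow_lt one_lt_two).1 (by omega)
    have h2 := hk₀ k (by omega)
    have h3 : M ≤ (L + 4 * A) * k := by
      have : 1 ≤ k := by omega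
      nlinarith
    have h4 : 6 * L * M ≤ 6 * L * (L + 4 * A) * k := by
      rw [mul_assoc (6 * L)]
      gcongr
    omega

/-- In a hyperbolic group, geodesics stay close to quasi-geodesic paths with the same ends. -/
theorem exists_geodesic_near_quasigeodesic (hS : Subgroup.closure (S : Set G) = ⊤) (hδ0 : 0 ≤ δ)
    (hδ : ∀ w x y z : G,
      min (gromovProduct S w x y) (gromovProduct S w y z) - δ ≤ gromovProduct S w x z) (L : ℕ) :
    ∃ C : ℕ, ∀ (f : ℕ → G) (n : ℕ), (∀ i < n, wordDist S (f i) (f (i + 1)) ≤ L) →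
      (∀ i j, i ≤ j → j ≤ n → j - i ≤ L * wordDist S (f i) (f j)) →
      ∀ q, wordDist S (f 0) q + wordDist S q (f n) = wordDist S (f 0) (f n) →
        ∃ i ≤ n, wordDist S q (f i) ≤ C := by
  obtain ⟨C, hC⟩ := exists_bound_of_le_log δ L
  refine ⟨C, fun f n hstep hqg q₀ hq₀ => ?_⟩
  let P : ℕ → Prop := fun M => ∃ q, wordDist S (f 0) q + wordDist S q (f n) =
    wordDist S (f 0) (f n) ∧ ∀ i ≤ n, M ≤ wordDist S q (f i)
  classical
  set B := wordDist S (f 0) (f n)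
  have hPB : ∀ M, P M → M ≤ B := by
    rintro M ⟨q, hq, hM⟩
    have := hM n le_rfl
    omega
  -- M is the largest distance to the path attained by a point between the two ends; the point q
  -- attains it.
  set M := Nat.findGreatest P B with hMdef
  have hPM : P M := Nat.findGreatest_spec (Nat.zero_le B) ⟨q₀, hq₀, fun _ _ => Nat.zero_le _⟩
  have hnear : ∀ q, wordDist S (f 0) q + wordDist S q (f n) = B →
      ∃ i ≤ n, wordDist S q (f i) ≤ M := by
    intro q hq
    by_contra! hcon
    have hP : P (M + 1) := ⟨q, hq, fun i hi => hcon i hi⟩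
    have := Nat.le_findGreatest (hPB _ hP) hP
    omega
  suffices hMC : M ≤ C by
    obtain ⟨i, hi, h⟩ := hnear q₀ hq₀
    exact ⟨i, hi, h.trans hMC⟩
  obtain ⟨q, hq, hfar⟩ := hPM
  -- a point at distance at most `2 * M` from `q` towards the end `f e`, and a path point near it
  have side : ∀ e ≤ n, (∀ x, wordDist S (f e) x + wordDist S x q = wordDist S (f e) q →
      wordDist S (f 0) x + wordDist S x (f n) = B) →
      ∃ x i, i ≤ n ∧ wordDist S (f e) x + wordDist S x q = wordDist S (f e) q ∧
        wordDist S x q ≤ 2 * M ∧ wordDist S x (f i) ≤ M ∧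
        (M : ℝ) ≤ gromovProduct S q x (f i) := by
    intro e he hside
    by_cases hle : wordDist S (f e) q ≤ 2 * M
    · refine ⟨f e, e, he, by simp [wordDist_self], hle, by simp [wordDist_self], ?_⟩
      rw [gromovProduct_self]
      exact_mod_cast hfar e he
    · obtain ⟨x, hx1, hx2⟩ := exists_between hS (f e) q (Nat.sub_le (wordDist S (f e) q) (2 * M))
      have hx3 : wordDist S x q = 2 * M := by omega
      obtain ⟨i, hi, hxi⟩ := hnear x (hside x (by omega))
      refine ⟨x, i, hi, by omega, hx3.le, hxi, ?_⟩
      have h1 := hfar i hi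
      rw [wordDist_comm hS] at hx3
      rw [gromovProduct, hx3]
      have h2 : (M : ℝ) ≤ wordDist S q (f i) := by exact_mod_cast h1
      have h3 : (wordDist S x (f i) : ℝ) ≤ M := by exact_mod_cast hxi
      push_cast
      linarith
  obtain ⟨x, i, hi, hx1, hx2, hx3, hx4⟩ := side 0 (Nat.zero_le n) fun x hx => by
    have h1 := wordDist_triangle hS x q (f n)
    have h2 := wordDist_triangle hS (f 0) x (f n)
    omega
  obtain ⟨y, j, hj, hy1, hy2, hy3, hy4⟩ := side n le_rfl fun x hx => by
    have h1 := wordDist_triangle hS (f 0) q x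
    have h2 := wordDist_triangle hS (f 0) x (f n)
    have h3 := wordDist_comm hS q x
    have h4 := wordDist_comm hS x (f n)
    have h5 := wordDist_comm hS q (f n)
    omega
  have hij : wordDist S (f i) (f j) ≤ 6 * M := by
    have h1 := wordDist_triangle hS (f i) x (f j)
    have h2 := wordDist_triangle hS x q (f j)
    have h3 := wordDist_triangle hS q y (f j)
    have h4 := wordDist_comm hS q y
    have h5 := wordDist_comm hS (f i) x
    omega
  -- q lies between x and y, while the chain x, f i, f j, y avoiding the M-ball around q makes this
  -- product at least M − L − (k + 2)δ.
  have hxy : gromovProduct S q x y ≤ 0 := by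
    have h1 := wordDist_triangle hS (f 0) x (f n)
    have h2 := wordDist_triangle hS x y (f n)
    have h3 := wordDist_comm hS x q
    have h4 := wordDist_comm hS y q
    have h5 := wordDist_comm hS (f n) q
    have h6 := wordDist_comm hS (f n) y
    have h7 : wordDist S q x + wordDist S q y ≤ wordDist S x y := by omega
    have h8 : (wordDist S q x : ℝ) + wordDist S q y ≤ wordDist S x y := by exact_mod_cast h7
    rw [gromovProduct]
    linarith
  refine hC M fun k hk => ?_
  have hidx : ∀ a b, a ≤ n → b ≤ n → wordDist S (f a) (f b) ≤ 6 * M → b ≤ a + 2 ^ k := by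
    intro a b ha hb hab
    rcases le_total b a with h | h
    · omega
    · have h1 := hqg a b h hb
      have h2 : L * wordDist S (f a) (f b) ≤ L * (6 * M) := Nat.mul_le_mul_left L hab
      have h3 : L * (6 * M) = 6 * L * M := by ring
      omega
  have hpath := le_gromovProduct_of_path hS hδ0 hδ (k := k) hstep hfar hi hj
    (hidx i j hi hj hij) (hidx j i hj hi (by rwa [wordDist_comm hS]))
  rw [gromovProduct_comm hS] at hy4
  have h1 := hδ q x (f i) y
  have h2 := hδ q (f i) (f j) y
  have hk0 : 0 ≤ k * δ := by positivity
  have hL0 : (0 : ℝ) ≤ L := by positivity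
  have h3 : (M : ℝ) - L - k * δ ≤ min (gromovProduct S q (f i) (f j)) (gromovProduct S q (f j) y) :=
    le_min hpath (by linarith)
  have h4 : (M : ℝ) - L - k * δ - δ ≤
      min (gromovProduct S q x (f i)) (gromovProduct S q (f i) y) :=
    le_min (by linarith) (by linarith)
  linarith

/-- Points at the same distance from `p`, on geodesics to `p` that start at `x` and `y`, are
close to each other once they are further from the starts than `x` and `y` are apart. -/
theorem wordDist_le_of_fellow (hS : Subgroup.closure (S : Set G) = ⊤)
    (hδ : ∀ w x y z : G,
      min (gromovProduct S w x y) (gromovProduct S w y z) - δ ≤ gromovProduct S w x z)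
    {p x y u v : G} (hu : wordDist S x u + wordDist S u p = wordDist S x p)
    (hv : wordDist S y v + wordDist S v p = wordDist S y p)
    (huv : wordDist S u p = wordDist S v p) (hxy : wordDist S x y ≤ wordDist S x u) :
    (wordDist S u v : ℝ) ≤ 4 * δ := by
  -- Along the chain u, x, y, v the products based at p are all at least d(p, u), so (u | v)_p ≥
  -- d(p, u) − 2δ; and (u | v)_p = d(p, u) − d(u, v)/2.
  have h1 := hδ p u x v
  have h2 := hδ p x y v
  have t1 := wordDist_triangle hS x y p
  rw [wordDist_comm hS u p] at hu huv
  rw [wordDist_comm hS v p] at hv huv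
  rw [wordDist_comm hS x p] at hu t1
  rw [wordDist_comm hS y p] at hv t1
  have e1 : (wordDist S x u : ℝ) + wordDist S p u = wordDist S p x := by exact_mod_cast hu
  have e2 : (wordDist S y v : ℝ) + wordDist S p v = wordDist S p y := by exact_mod_cast hv
  have e3 : (wordDist S p u : ℝ) = wordDist S p v := by exact_mod_cast huv
  have e4 : (wordDist S x y : ℝ) ≤ wordDist S x u := by exact_mod_cast hxy
  have t2 : (wordDist S p x : ℝ) ≤ wordDist S x y + wordDist S p y := by exact_mod_cast t1
  have g1 : gromovProduct S p u x = wordDist S p u := by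
    rw [gromovProduct, wordDist_comm hS u x]; linarith
  have g2 : gromovProduct S p y v = wordDist S p v := by
    rw [gromovProduct]; linarith
  have g3 : (wordDist S p u : ℝ) ≤ gromovProduct S p x y := by
    rw [gromovProduct]; linarith
  have h3 : (wordDist S p u : ℝ) ≤ min (gromovProduct S p x y) (gromovProduct S p y v) :=
    le_min g3 (by linarith)
  have h5 : 0 ≤ δ := by
    have := hδ p p p p
    rw [min_self] at this
    linarith
  have h4 : (wordDist S p u : ℝ) - δ ≤
      min (gromovProduct S p u x) (gromovProduct S p x v) :=
    le_min (by linarith) (by linarith)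
  have g4 : gromovProduct S p u v = wordDist S p u - wordDist S u v / 2 := by
    rw [gromovProduct]; linarith
  linarith

end Hyperbolic

/-! ### A square-free ternary sequence -/

section ThueMorse

/-- The Thue–Morse sequence: the parity of the number of binary digits `1`. -/
def thueMorse (n : ℕ) : Bool :=
  Nat.binaryRec false (fun b _ t => xor b t) n

theorem thueMorse_two_mul (n : ℕ) : thueMorse (2 * n) = thueMorse n := by
  have := Nat.binaryRec_eq (motive := fun _ => Bool) (zero := false)
    (bit := fun b _ t => xor b t) false n (Or.inl rfl)
  simpa [thueMorse, Nat.bit] using this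

theorem thueMorse_two_mul_add_one (n : ℕ) : thueMorse (2 * n + 1) = !thueMorse n := by
  have := Nat.binaryRec_eq (motive := fun _ => Bool) (zero := false)
    (bit := fun b _ t => xor b t) true n (Or.inl rfl)
  simpa [thueMorse, Nat.bit] using this

theorem thueMorse_succ_of_even {n : ℕ} (hn : Even n) : thueMorse (n + 1) = !thueMorse n := by
  obtain ⟨m, rfl⟩ := hn.two_dvd
  rw [thueMorse_two_mul, thueMorse_two_mul_add_one]

/-- An overlap of even period restricts, at positions of one parity, to one of half the period. For
odd period, one of the two copies of each position is even, so the sequence alternates throughout,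
contradicting the odd period. -/
theorem thueMorse_overlapFree (n : ℕ) (hn : 0 < n) (i : ℕ) :
    ¬ ∀ j ≤ n, thueMorse (i + j) = thueMorse (i + n + j) := by
  induction n using Nat.strong_induction_on generalizing i with
  | _ n ih =>
  intro h
  rcases Nat.even_or_odd' n with ⟨m, rfl | rfl⟩
  · rcases Nat.even_or_odd' i with ⟨k, rfl | rfl⟩
    · refine ih m (by omega) (by omega) k fun j hj => ?_
      have := h (2 * j) (by omega)
      rwa [← mul_add, ← mul_add, ← mul_add, thueMorse_two_mul, thueMorse_two_mul] at this
    · refine ih m (by omega) (by omega) k fun j hj => ?_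
      have := h (2 * j) (by omega)
      rw [show 2 * k + 1 + 2 * j = 2 * (k + j) + 1 by ring,
        show 2 * k + 1 + 2 * m + 2 * j = 2 * (k + m + j) + 1 by ring,
        thueMorse_two_mul_add_one, thueMorse_two_mul_add_one] at this
      simpa using this
  · have alt : ∀ j < 2 * m + 1, thueMorse (i + j + 1) = !thueMorse (i + j) := by
      intro j hj
      rcases Nat.even_or_odd (i + j) with he | ho
      · exact thueMorse_succ_of_even he
      · have h1 := h j hj.le
        have h2 := h (j + 1) hj
        rw [← add_assoc, ← add_assoc] at h2
        rw [h1, h2]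
        apply thueMorse_succ_of_even
        rw [show i + (2 * m + 1) + j = (i + j) + (2 * m + 1) by ring]
        exact ho.add_odd ⟨m, rfl⟩
    have alt2 : ∀ j ≤ m, thueMorse (i + 2 * j) = thueMorse i := by
      intro j
      induction j with
      | zero => simp
      | succ j ihj =>
        intro hj
        have h1 := alt (2 * j) (by omega)
        have h2 := alt (2 * j + 1) (by omega)
        rw [show i + 2 * (j + 1) = i + (2 * j + 1) + 1 by ring, h2, ← add_assoc, h1,
          Bool.not_not, ihj (by omega)]
    have h1 := alt (2 * m) (by omega)
    have h2 := h 0 (by omega)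
    rw [alt2 m le_rfl] at h1
    rw [add_zero, add_zero, ← add_assoc, h1] at h2
    cases hb : thueMorse i <;> simp [hb] at h2

/-- The difference sequence of the Thue–Morse sequence. -/
def thueMorseDiff (n : ℕ) : Fin 3 :=
  match thueMorse n, thueMorse (n + 1) with
  | false, true => 0
  | true, false => 1
  | _, _ => 2

theorem thueMorseDiff_isSquareFree : IsSquareFreeSeq thueMorseDiff := by
  intro i n hn
  by_contra! h
  have step : ∀ a b : ℕ, thueMorseDiff a = thueMorseDiff b →
      (thueMorse (a + 1)).toInt - (thueMorse a).toInt =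
        (thueMorse (b + 1)).toInt - (thueMorse b).toInt := by
    intro a b
    unfold thueMorseDiff
    cases thueMorse a <;> cases thueMorse (a + 1) <;> cases thueMorse b <;>
      cases thueMorse (b + 1) <;> simp
  have key : ∀ j ≤ n, (thueMorse (i + j)).toInt - (thueMorse i).toInt =
      (thueMorse (i + n + j)).toInt - (thueMorse (i + n)).toInt := by
    intro j
    induction j with
    | zero => simp
    | succ j ihj =>
      intro hj
      have h1 := step _ _ (h j (by omega))
      have h2 := ihj (by omega)
      rw [← add_assoc, ← add_assoc]
      omega
  -- The values at i, i + n, i + 2n form an arithmetic progression in {0, 1}, hence are constant.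
  have hends : thueMorse i = thueMorse (i + n) := by
    have := key n le_rfl
    revert this
    cases thueMorse i <;> cases thueMorse (i + n) <;> cases thueMorse (i + n + n) <;> simp
  refine thueMorse_overlapFree n hn i fun j hj => ?_
  have := key j hj
  rw [hends, sub_left_inj] at this
  revert this
  cases thueMorse (i + j) <;> cases thueMorse (i + n + j) <;> simp

end ThueMorse

/-! ### Uniform conjugation of almost-stabilizers of a far point -/

section QuasiIsometry

variable {G : Type*} [Group G] {S₀ S : Finset G} {δ : ℝ}

/-- If every element of a finite set `A` preserves the distance to a far away point `p` on a large
ball, then the elements of `A` are simultaneously conjugate into a ball whose radius does not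
depend on `A`. The metric in question may belong to any finite generating set. -/
theorem exists_conj_wordNorm_le (hS₀ : Subgroup.closure (S₀ : Set G) = ⊤)
    (hδ0 : 0 ≤ δ) (hδ : ∀ w x y z : G,
      min (gromovProduct S₀ w x y) (gromovProduct S₀ w y z) - δ ≤ gromovProduct S₀ w x z)
    (hS : Subgroup.closure (S : Set G) = ⊤) :
    ∃ C : ℕ, ∀ A : Finset G, ∃ R : ℕ, ∀ p : G, R ≤ wordNorm S p →
      (∀ a ∈ A, ∀ y, wordNorm S y ≤ R → wordDist S p (a * y) = wordDist S p y) →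
      ∃ s : G, ∀ a ∈ A, wordNorm S (s⁻¹ * a * s) ≤ C := by
  obtain ⟨L₁, hL₁⟩ := exists_wordNorm_le_mul hS hS₀
  obtain ⟨L₂, hL₂⟩ := exists_wordNorm_le_mul hS₀ hS
  set L := L₁ + L₂
  have hd : ∀ x y, wordDist S x y ≤ L * wordDist S₀ x y := fun x y =>
    (hL₁ _).trans (Nat.mul_le_mul_right _ (Nat.le_add_right _ _))
  have hd₀ : ∀ x y, wordDist S₀ x y ≤ L * wordDist S x y := fun x y =>
    (hL₂ _).trans (Nat.mul_le_mul_right _ (Nat.le_add_left _ _))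
  obtain ⟨C₀, hC₀⟩ := exists_geodesic_near_quasigeodesic hS₀ hδ0 hδ L
  obtain ⟨D₄, hD₄⟩ := exists_nat_ge (4 * δ)
  set E := L * (2 * C₀ + D₄) with hE
  refine ⟨2 * E, fun A => ?_⟩
  set K := A.sup (wordNorm S₀)
  -- The times satisfy s ≤ L(K + C₀) and t ≤ s + E ≤ T, so f t = aγ t. A radius above T + LK puts γ
  -- up to T in the ball and gives T < D and K ≤ d₀(1, p).
  set T := L * (K + C₀) + E with hT
  refine ⟨T + L * K + 1, fun p hp hinv => ?_⟩
  set D := wordDist S 1 p with hD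
  rw [← wordDist_one_left, ← hD] at hp
  have hnear : ∀ (f : ℕ → G), f D = p → wordDist S (f 0) p = D →
      (∀ i, wordDist S (f i) (f (i + 1)) ≤ 1) →
      ∀ q, wordDist S₀ (f 0) q + wordDist S₀ q p = wordDist S₀ (f 0) p →
        ∃ i ≤ D, wordDist S₀ q (f i) ≤ C₀ := by
    intro f hfD hf0 hf q hq
    rw [← hfD] at hq hf0
    refine hC₀ f D (fun i _ => ?_) (fun i j hij hj => ?_) q hq
    · exact (hd₀ _ _).trans (by simpa using Nat.mul_le_mul_left L (hf i))
    · rw [← wordDist_eq_of_steps hS hf hf0 hij hj]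
      exact hd _ _
  obtain ⟨γ, hγ0, hγD, hγ⟩ := exists_geodesic hS 1 p
  rw [← hD] at hγD
  have hγn : wordDist S (γ 0) (γ D) = D := by rw [hγ0, hγD]
  have hKD : K ≤ wordDist S₀ 1 p := by
    by_contra! hlt
    have h1 := hd 1 p
    have h2 := Nat.mul_le_mul_left L hlt.le
    omega
  obtain ⟨q, hq1, hq2⟩ := exists_between hS₀ 1 p hKD
  obtain ⟨s, hsD, hs⟩ := hnear γ hγD (by rw [hγ0]) hγ q (by rw [hγ0]; omega)
  have hsle : s ≤ L * (K + C₀) := by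
    have h1 : wordDist S 1 (γ s) = s := by
      simpa [hγ0] using wordDist_eq_of_steps hS hγ hγn (Nat.zero_le s) hsD
    rw [← h1]
    refine (hd _ _).trans (Nat.mul_le_mul_left L ?_)
    have := wordDist_triangle hS₀ 1 q (γ s)
    omega
  refine ⟨γ s, fun a ha => ?_⟩
  have hball : ∀ t ≤ T, wordNorm S (γ t) ≤ T + L * K + 1 := by
    intro t ht
    have := wordDist_le_of_steps hS hγ 0 t
    rw [hγ0, zero_add, wordDist_one_left] at this
    omega
  -- the translate by `a` of an initial piece of `γ`, continued by a geodesic to `p`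
  obtain ⟨f, hf0, hfD, hf, hfT⟩ : ∃ f : ℕ → G, f 0 = a ∧ f D = p ∧
      (∀ i, wordDist S (f i) (f (i + 1)) ≤ 1) ∧ ∀ t ≤ T, f t = a * γ t := by
    obtain ⟨β, hβ0, hβn, hβ⟩ := exists_geodesic hS (a * γ T) p
    -- The concatenation thus has length D = d(a, p), so it is geodesic.
    have hlen : wordDist S (a * γ T) p = D - T := by
      rw [wordDist_comm hS, hinv a ha _ (hball T le_rfl), wordDist_comm hS]
      simpa [hγD] using wordDist_eq_of_steps hS hγ hγn (show T ≤ D by omega) le_rfl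
    rw [hlen] at hβn
    refine ⟨fun t => if t ≤ T then a * γ t else β (t - T), by simp [hγ0], ?_, fun i => ?_,
      fun t ht => if_pos ht⟩
    · dsimp only
      rw [if_neg (by omega), hβn]
    · dsimp only
      rcases lt_trichotomy i T with h | rfl | h
      · rw [if_pos h.le, if_pos (by omega), wordDist_mul_left]
        exact hγ i
      · rw [if_pos le_rfl, if_neg (by omega), ← hβ0, Nat.add_sub_cancel_left]
        exact hβ 0
      · rw [if_neg (by omega), if_neg (by omega), Nat.sub_add_comm h.le]
        exact hβ _
  have hap : wordDist S a p = D := by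
    have := hinv a ha 1 (by simp [wordNorm_one])
    rw [mul_one] at this
    rw [wordDist_comm hS, this, wordDist_comm hS]
  have haK : wordDist S₀ 1 a ≤ K := by
    rw [wordDist_one_left]
    exact Finset.le_sup (f := wordNorm S₀) ha
  -- r is as far from p as q is; the subtraction does not truncate, because d₀(1, a) ≤ K = d₀(1, q).
  obtain ⟨r, hr1, hr2⟩ := exists_between hS₀ a p
    (Nat.sub_le (wordDist S₀ a p) (wordDist S₀ q p))
  have htri := wordDist_triangle hS₀ 1 a p
  have hqr : wordDist S₀ q r ≤ D₄ := by
    have h1 := wordDist_le_of_fellow hS₀ hδ (p := p) (x := 1) (y := a) (u := q) (v := r)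
      (by omega) (by omega) (by omega) (by omega)
    exact_mod_cast h1.trans hD₄
  obtain ⟨t, htD, ht⟩ := hnear f hfD (by rw [hf0, hap]) hf r (by rw [hf0]; omega)
  have hclose : wordDist S (γ s) (f t) ≤ E := by
    refine (hd _ _).trans (Nat.mul_le_mul_left L ?_)
    have h1 := wordDist_triangle hS₀ (γ s) q (f t)
    have h2 := wordDist_triangle hS₀ q r (f t)
    have h3 := wordDist_comm hS₀ (γ s) q
    omega
  have hsp : wordDist S (γ s) p = D - s := by
    simpa [hγD] using wordDist_eq_of_steps hS hγ hγn hsD le_rfl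
  have htp : wordDist S (f t) p = D - t := by
    have h1 : wordDist S (f 0) (f D) = D := by rw [hf0, hfD, hap]
    simpa [hfD] using wordDist_eq_of_steps hS hf h1 htD le_rfl
  have h1 := wordDist_triangle hS (γ s) (f t) p
  have h2 := wordDist_triangle hS (f t) (γ s) p
  have h3 := wordDist_comm hS (f t) (γ s)
  -- The distances D − s and D − t to p differ by at most E.
  have hst : wordDist S (γ t) (γ s) ≤ E := by
    rcases le_total s t with h | h
    · rw [wordDist_comm hS, wordDist_eq_of_steps hS hγ hγn h htD]
      omega
    · rw [wordDist_eq_of_steps hS hγ hγn h hsD]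
      omega
  rw [hfT t (by omega)] at hclose
  have h4 := wordDist_triangle hS (γ s) (a * γ t) (a * γ s)
  rw [wordDist_mul_left] at h4
  rw [mul_assoc]
  change wordDist S (γ s) (a * γ s) ≤ 2 * E
  omega

end QuasiIsometry

/-! ### Periods of limit colorings -/

section LimitColorings

variable {G : Type*} [Group G]

theorem exists_eqOn_of_mem_closure {F : Type*} [TopologicalSpace F] [DiscreteTopology F]
    {φ ψ : G → F} (hψ : ψ ∈ closure (Set.range fun g : G => translate g φ)) {B : Set G}
    (hB : B.Finite) : ∃ p : G, ∀ y ∈ B, ψ y = φ (p⁻¹ * y) := by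
  obtain ⟨χ, hχ, p, rfl⟩ := mem_closure_iff.1 hψ (B.pi fun y => {ψ y})
    (isOpen_set_pi hB fun _ _ => isOpen_discrete _) fun _ _ => rfl
  exact ⟨p, fun y hy => (hχ y hy).symm⟩

theorem IsLimitAperiodic.equiv_comp {F F' : Type*} [TopologicalSpace F] [DiscreteTopology F]
    [TopologicalSpace F'] [DiscreteTopology F'] {φ : G → F} (hφ : IsLimitAperiodic φ)
    (e : F ≃ F') : IsLimitAperiodic fun x => e (φ x) := by
  intro ψ hψ g hg hfix
  have hcont : Continuous fun χ : G → F' => fun x => e.symm (χ x) :=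
    continuous_pi fun x => continuous_of_discreteTopology.comp (continuous_apply x)
  refine hφ (fun x => e.symm (ψ x)) ?_ g hg ?_
  · have h := image_closure_subset_closure_image hcont (Set.mem_image_of_mem _ hψ)
    refine closure_mono ?_ h
    rintro _ ⟨_, ⟨k, rfl⟩, rfl⟩
    exact ⟨k, by funext x; simp [translate]⟩
  · funext x
    exact congrArg e.symm (congrFun hfix x)

/-- An increment in {−1, 0, 1} is determined by its residue mod 3. -/
theorem sub_eq_sub_of_mod_three_eq {u v : ℕ → ℕ} {n : ℕ}
    (hu : ∀ i, u i ≤ u (i + 1) + 1 ∧ u (i + 1) ≤ u i + 1)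
    (hv : ∀ i, v i ≤ v (i + 1) + 1 ∧ v (i + 1) ≤ v i + 1)
    (h : ∀ i ≤ n, u i % 3 = v i % 3) : (u n : ℤ) - u 0 = v n - v 0 := by
  induction n with
  | zero => simp
  | succ n ih =>
    have h1 := ih fun i hi => h i (by omega)
    have h2 := h n (by omega)
    have h3 := h (n + 1) le_rfl
    have h4 := hu n
    have h5 := hv n
    omega

variable {S : Finset G} {ν : ℕ → Fin 3} {ψ : G → Fin 3 × Fin 3} {g : G}

theorem normColoring_inv_mul (p y : G) : normColoring S ν (p⁻¹ * y) =
    (ν (wordDist S p y), ⟨wordDist S p y % 3, Nat.mod_lt _ (by norm_num)⟩) :=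
  rfl

theorem wordDist_step (hS : Subgroup.closure (S : Set G) = ⊤) (p : G) {x y : G}
    (h : wordDist S x y ≤ 1) :
    wordDist S p x ≤ wordDist S p y + 1 ∧ wordDist S p y ≤ wordDist S p x + 1 := by
  have h1 := wordDist_triangle hS p x y
  have h2 := wordDist_triangle hS p y x
  have h3 := wordDist_comm hS x y
  omega

theorem mod_three_eq_of_normColoring_eq {p q x y : G}
    (h : normColoring S ν (p⁻¹ * x) = normColoring S ν (q⁻¹ * y)) :
    wordDist S p x % 3 = wordDist S q y % 3 := by
  simpa [normColoring_inv_mul] using congrArg (fun c => (c.2 : ℕ)) h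

/-- A period `g` of a limit coloring shifts the distances to an approximating centre `p` by a
constant. -/
theorem exists_wordDist_shift (hS : Subgroup.closure (S : Set G) = ⊤)
    (hψ : ψ ∈ closure (Set.range fun g : G => translate g (normColoring S ν)))
    (hfix : ∀ x, ψ (g * x) = ψ x) :
    ∃ c : ℤ, ∀ (R : ℕ) (p : G),
      (∀ y, wordNorm S y ≤ R + wordNorm S g → ψ y = normColoring S ν (p⁻¹ * y)) →
      ∀ y, wordNorm S y ≤ R → (wordDist S p (g * y) : ℤ) = wordDist S p y + c := by
  obtain ⟨p₀, hp₀⟩ := exists_eqOn_of_mem_closure hψ (finite_wordNorm_le hS (wordNorm S g))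
  refine ⟨wordDist S p₀ g - wordDist S p₀ 1, fun R p hp y hy => ?_⟩
  have h1 : (wordDist S p (g * y) : ℤ) - wordDist S p g = wordDist S p y - wordDist S p 1 := by
    obtain ⟨γ, hγ0, hγn, hγ⟩ := exists_geodesic hS 1 y
    have := sub_eq_sub_of_mod_three_eq (n := wordDist S 1 y)
      (fun i => wordDist_step hS p (by rw [wordDist_mul_left g]; exact hγ i))
      (fun i => wordDist_step hS p (hγ i)) (fun i hi => ?_)
    · simpa [hγ0, hγn] using this
    · have hi' := wordDist_le_of_steps hS hγ 0 i
      rw [hγ0, zero_add, wordDist_one_left] at hi'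
      rw [wordDist_one_left] at hi
      refine mod_three_eq_of_normColoring_eq (ν := ν) ?_
      have := wordNorm_mul_le hS g (γ i)
      rw [← hp (g * γ i) (by omega), ← hp (γ i) (by omega), hfix]
  -- Both sides are read off from ψ along one geodesic from 1 to g, which makes c independent of p
  -- and R.
  have h2 : (wordDist S p g : ℤ) - wordDist S p 1 = wordDist S p₀ g - wordDist S p₀ 1 := by
    obtain ⟨γ, hγ0, hγn, hγ⟩ := exists_geodesic hS 1 g
    have := sub_eq_sub_of_mod_three_eq (n := wordDist S 1 g)
      (fun i => wordDist_step hS p (hγ i)) (fun i => wordDist_step hS p₀ (hγ i)) (fun i hi => ?_)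
    · simpa [hγ0, hγn] using this
    · have hi' := wordDist_le_of_steps hS hγ 0 i
      rw [hγ0, zero_add, wordDist_one_left] at hi'
      rw [wordDist_one_left] at hi
      refine mod_three_eq_of_normColoring_eq (ν := ν) ?_
      rw [← hp _ (by omega), ← hp₀ (γ i) (show wordNorm S (γ i) ≤ wordNorm S g by omega)]
  linarith

/-- A positive shift would produce a square in `ν`. -/
theorem shift_nonpos (hS : Subgroup.closure (S : Set G) = ⊤) (hν : IsSquareFreeSeq ν)
    (hψ : ψ ∈ closure (Set.range fun g : G => translate g (normColoring S ν)))
    (hfix : ∀ x, ψ (g * x) = ψ x) {c : ℤ} (hc : ∀ (R : ℕ) (p : G),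
      (∀ y, wordNorm S y ≤ R + wordNorm S g → ψ y = normColoring S ν (p⁻¹ * y)) →
      ∀ y, wordNorm S y ≤ R → (wordDist S p (g * y) : ℤ) = wordDist S p y + c) : c ≤ 0 := by
  by_contra! hpos
  lift c to ℕ using hpos.le
  obtain ⟨p, hp⟩ := exists_eqOn_of_mem_closure hψ
    (finite_wordNorm_le hS (c + wordNorm S g + wordNorm S g))
  replace hc := hc _ p hp
  obtain ⟨γ, hγ0, hγD, hγ⟩ := exists_geodesic hS 1 p
  -- Since d(p, 1) = d(p, g⁻¹) + c, the subtraction in the start of the square below does not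
  -- truncate.
  have hcD : c ≤ wordDist S 1 p := by
    have := hc g⁻¹ (by rw [wordNorm_inv hS]; omega)
    rw [mul_inv_cancel, wordDist_comm hS p 1] at this
    omega
  have hγn : wordDist S (γ 0) (γ (wordDist S 1 p)) = wordDist S 1 p := by rw [hγ0, hγD]
  -- With D = d(1, p), the distances D − c + 1, …, D occur at γ t for t < c; g raises each by c and
  -- preserves the color, so ν repeats this block.
  obtain ⟨j, hj, hne⟩ := hν (wordDist S 1 p - c + 1) c (by omega)
  set t := c - 1 - j with ht
  have hnorm : wordNorm S (γ t) ≤ t := by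
    simpa [hγ0, wordDist_one_left] using wordDist_le_of_steps hS hγ 0 t
  have h1 : wordDist S p (γ t) = wordDist S 1 p - t := by
    rw [wordDist_comm hS]
    simpa [hγD] using wordDist_eq_of_steps hS hγ hγn (show t ≤ wordDist S 1 p by omega) le_rfl
  have h2 := hc (γ t) (by omega)
  have h3 := wordNorm_mul_le hS g (γ t)
  have h4 := hfix (γ t)
  have hball : ∀ y, wordNorm S y ≤ c + wordNorm S g + wordNorm S g →
      ψ y = normColoring S ν (p⁻¹ * y) := hp
  rw [hball (g * γ t) (by omega), hball (γ t) (by omega), normColoring_inv_mul,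
    normColoring_inv_mul] at h4
  have h5 := congrArg Prod.fst h4
  simp only at h5
  apply hne
  rw [show wordDist S 1 p - c + 1 + j = wordDist S p (γ t) by omega,
    show wordDist S 1 p - c + 1 + c + j = wordDist S p (g * γ t) by omega, h5]

theorem wordDist_period_mul (hS : Subgroup.closure (S : Set G) = ⊤) (hν : IsSquareFreeSeq ν)
    (hψ : ψ ∈ closure (Set.range fun g : G => translate g (normColoring S ν)))
    (hfix : ∀ x, ψ (g * x) = ψ x) {R : ℕ} {p : G}
    (hp : ∀ y, wordNorm S y ≤ R + wordNorm S g → ψ y = normColoring S ν (p⁻¹ * y)) {y : G}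
    (hy : wordNorm S y ≤ R) : wordDist S p (g * y) = wordDist S p y := by
  have hfix' : ∀ x, ψ (g⁻¹ * x) = ψ x := fun x => by rw [← hfix, mul_inv_cancel_left]
  obtain ⟨c, hc⟩ := exists_wordDist_shift hS hψ hfix
  obtain ⟨c', hc'⟩ := exists_wordDist_shift hS hψ hfix'
  have h1 := shift_nonpos hS hν hψ hfix hc
  have h2 := shift_nonpos hS hν hψ hfix' hc'
  obtain ⟨q, hq⟩ := exists_eqOn_of_mem_closure hψ
    (finite_wordNorm_le hS (wordNorm S g + wordNorm S g))
  -- Comparing 1 with g⁻¹ gives c + c' = 0, so both vanish.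
  have h3 := hc _ q hq g⁻¹ (wordNorm_inv hS g).le
  have h4 := hc' (wordNorm S g) q (by rwa [wordNorm_inv hS]) 1 (by simp [wordNorm_one])
  rw [mul_inv_cancel] at h3
  rw [mul_one] at h4
  have h5 := hc R p hp y hy
  omega

theorem wordDist_period_pow_mul (hS : Subgroup.closure (S : Set G) = ⊤) (hν : IsSquareFreeSeq ν)
    (hψ : ψ ∈ closure (Set.range fun g : G => translate g (normColoring S ν)))
    (hfix : ∀ x, ψ (g * x) = ψ x) {R : ℕ} {p : G} (n : ℕ)
    (hp : ∀ y, wordNorm S y ≤ R + n * wordNorm S g → ψ y = normColoring S ν (p⁻¹ * y)) {y : G}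
    (hy : wordNorm S y ≤ R) : wordDist S p (g ^ n * y) = wordDist S p y := by
  induction n generalizing R y with
  | zero => simp
  | succ n ih =>
    rw [add_mul, one_mul] at hp
    rw [pow_succ, mul_assoc, ih (R := R + wordNorm S g) (fun z hz => hp z (by omega)),
      wordDist_period_mul hS hν hψ hfix (fun z hz => hp z (by omega)) hy]
    have := wordNorm_mul_le hS g y
    omega

theorem isLimitAperiodic_normColoring (hhyp : IsHyperbolicGroup G) (htf : IsTorsionFreeGroup G)
    (hS : Subgroup.closure (S : Set G) = ⊤) (hν : IsSquareFreeSeq ν) :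
    IsLimitAperiodic (normColoring S ν) := by
  intro ψ hψ g hg htr
  have hfix : ∀ x, ψ (g * x) = ψ x := fun x => by
    simpa [translate] using (congrFun htr (g * x)).symm
  obtain ⟨S₀, hS₀, δ, hδ⟩ := hhyp
  have hδ0 : 0 ≤ δ := by
    have := hδ 1 1 1 1
    rw [min_self] at this
    linarith
  obtain ⟨C, hC⟩ := exists_conj_wordNorm_le hS₀ hδ0 hδ hS
  classical
  set B := (finite_wordNorm_le hS C).toFinset with hB
  -- C is fixed before the set of powers, so one more power than the C-ball has elements can be
  -- used.
  obtain ⟨R, hR⟩ := hC ((Finset.range (B.card + 1)).image (g ^ ·))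
  obtain ⟨p, hp⟩ := exists_eqOn_of_mem_closure hψ
    (finite_wordNorm_le hS (R + (B.card + 1) * wordNorm S g))
  obtain ⟨s, hs⟩ := hR p (by
    by_contra! hlt
    have h := wordDist_period_mul hS hν hψ hfix (R := R) (p := p) (fun y hy => hp y ?_) hlt.le
    · rw [wordDist_self] at h
      exact hg (by simpa using eq_of_wordDist_eq_zero hS h)
    · refine hy.trans ?_
      gcongr
      exact Nat.le_mul_of_pos_left _ (Nat.succ_pos _)) (by
    intro a ha y hy
    obtain ⟨n, hn, rfl⟩ := Finset.mem_image.1 ha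
    refine wordDist_period_pow_mul hS hν hψ hfix n (fun z hz => hp z (hz.trans ?_)) hy
    gcongr
    exact (Finset.mem_range.1 hn).le)
  obtain ⟨i, -, j, -, hij, heq⟩ := Finset.exists_ne_map_eq_of_card_lt_of_maps_to
    (s := Finset.range (B.card + 1)) (t := B) (f := fun n => s⁻¹ * g ^ n * s) (by simp)
    (fun n hn => by
      rw [hB, Set.Finite.coe_toFinset]
      exact hs _ (Finset.mem_image_of_mem _ hn))
  refine hij (injective_pow_iff_not_isOfFinOrder.2 (htf g hg) ?_)
  simpa using heq

end LimitColorings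

end AperiodicColoring

theorem theorem2 {G : Type*} [Group G]
    (hhyp : AperiodicColoring.IsHyperbolicGroup G)
    (htf : AperiodicColoring.IsTorsionFreeGroup G) :
    (∃ φ : G → Fin 9, AperiodicColoring.IsLimitAperiodic φ) ∧
    (∃ ν : ℕ → Fin 3, AperiodicColoring.IsSquareFreeSeq ν) ∧
    (∀ S : Finset G, Subgroup.closure (S : Set G) = ⊤ →
      ∀ ν : ℕ → Fin 3, AperiodicColoring.IsSquareFreeSeq ν →
        AperiodicColoring.IsLimitAperiodic (AperiodicColoring.normColoring S ν)) := by
  refine ⟨?_, ⟨_, AperiodicColoring.thueMorseDiff_isSquareFree⟩, fun S hS ν hν =>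
    AperiodicColoring.isLimitAperiodic_normColoring hhyp htf hS hν⟩
  obtain ⟨S, hS, -⟩ := id hhyp
  exact ⟨_, (AperiodicColoring.isLimitAperiodic_normColoring hhyp htf hS
    AperiodicColoring.thueMorseDiff_isSquareFree).equiv_comp finProdFinEquiv⟩
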